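/- A sporadic task $\tau_i=(C_i,T_i,D_i)$ has worst-case execution time $C_i>0$, minimum inter-arrival time $T_i$ and relative deadline $D_i$; it has a constrained deadline if $0<D_i\le T_i$. Write $U_i=C_i/T_i$. A finite task set is \emph{feasible} on $M$ identical unit-speed processors if for every legal arrival pattern of its jobs (first jobs arriving at time $0$ or later, consecutive jobs of $\tau_i$ at least $T_i$ apart) there is a preemptive schedule, migration allowed, in which every job of $\tau_i$ receives $C_i$ units of execution within $D_i$ time units after its arrival, no processor runs two jobs at a time and no job runs on two processors at a time. It is \emph{partitioned feasible} if its tasks can be distributed over the $M$ processors so that the tasks on each processor are feasible on that single processor. Deadline-monotonic (DM) partitioning takes tasks sorted by non-decreasing $D_i$, puts $\tau_1$ on processor $1$ and then, for $k=2,3,\dots$, puts $\tau_k$ on some processor $m$ for which $\tau_k$ passes a schedulability test against the set $\mathbf T_m$ of tasks already placed on $m$; it fails if there is no such $m$. With arbitrary fitting, any processor passing the test may be chosen. Two tests are considered: \begin{itemize} \item time-demand analysis (TDA): there is $t\in(0,D_k]$ with $C_k+\sum_{\tau_i\in\mathbf T_m}\lceil t/T_i\rceil C_i\le t$; \item the hyperbolic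 bound: $\Bigl(\frac{C_k+\sum_{\tau_i\in \mathbf T_m,\,T_i\ge D_k}C_i}{D_k}+1\Bigr)\prod_{\tau_i\in \mathbf T_m,\,T_i<D_k}(U_i+1)\le 2$. \end{itemize} For $\rho>0$, DM partitioning with arbitrary fitting and a given test has speedup factor $\rho$ on $M$ processors if, for every constrained-deadline task set that is feasible on $M$ unit-speed processors, no run of the algorithm on $M$ processors of speed $\rho$ (that is, with every $C_i$ replaced by $C_i/\rho$) fails. Let $W$ be the Lambert W function, $z=W(z)e^{W(z)}$. \textbf{Theorem.} $\left|\frac1{W(1/2)}-2.84306\right|<5\cdot10^{-6}$, and for every $\varepsilon>0$ there is $M_0$ such that for all $M\ge M_0$ and each of the two tests (TDA and the hyperbolic bound), every speedup factor $\rho$ of DM partitioning with arbitrary fitting on $M$ processors for constrained-deadline task sets satisfies $$\rho\ \ge\ \frac1{W(1/2)}-\varepsilon .$$ The same holds if in the definition of the speedup factor "feasible" is replaced by "partitioned feasible". -/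

import Mathlib

open Set Filter Topology MeasureTheory
open scoped BigOperators ENNReal

noncomputable section

/-- The principal branch of the Lambert W function on the reals: the inverse of
`w ↦ w * exp w` restricted to `[-1, ∞)`. -/
def lambertW (z : ℝ) : ℝ :=
  Function.invFunOn (fun w : ℝ => w * Real.exp w) (Set.Ici (-1)) z

/-- For `z ≥ 0` the equation `w * exp w = z` has exactly one real solution, and it is
`lambertW z`. -/
theorem lambertW_eq_iff {z : ℝ} (hz : 0 ≤ z) (w : ℝ) :
    w * Real.exp w = z ∧ 0 ≤ w ↔ w = lambertW z := by
  have hcont : Continuous (fun w : ℝ => w * Real.exp w) := by fun_prop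
  have hex : ∃ a ∈ Set.Ici (-1 : ℝ), (fun w : ℝ => w * Real.exp w) a = z := by
    have h1 : z ∈ Set.Icc ((fun w : ℝ => w * Real.exp w) 0)
        ((fun w : ℝ => w * Real.exp w) z) := by
      refine ⟨by simpa using hz, ?_⟩
      have : 1 ≤ Real.exp z := Real.one_le_exp hz
      simpa using le_mul_of_one_le_right hz this
    obtain ⟨a, ha, h⟩ := intermediate_value_Icc hz hcont.continuousOn h1
    exact ⟨a, le_trans (by norm_num) ha.1, h⟩
  have hspec : lambertW z * Real.exp (lambertW z) = z := Function.invFunOn_eq hex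
  have hnn : 0 ≤ lambertW z := by
    by_contra hneg
    push Not at hneg
    have := mul_neg_of_neg_of_pos hneg (Real.exp_pos (lambertW z))
    linarith
  have hmono : ∀ a b : ℝ, 0 ≤ a → a < b → a * Real.exp a < b * Real.exp b := by
    intro a b ha hab
    have h2 : Real.exp a < Real.exp b := Real.exp_lt_exp.mpr hab
    exact mul_lt_mul hab h2.le (Real.exp_pos a) (ha.trans hab.le)
  constructor
  · rintro ⟨h, hw⟩
    rcases lt_trichotomy w (lambertW z) with hlt | heq | hgt
    · have := hmono _ _ hw hlt
      linarith
    · exact heq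
    · have := hmono _ _ hnn hgt
      linarith
  · rintro rfl
    exact ⟨hspec, hnn⟩

/-- A sporadic task: worst-case execution time `C`, minimum inter-arrival time (period) `T`,
relative deadline `D`. -/
structure SporadicTask where
  C : ℝ
  T : ℝ
  D : ℝ

namespace SporadicTask

/-- A genuine task with constrained deadline: positive parameters and `D ≤ T`. -/
def IsConstrained (a : SporadicTask) : Prop :=
  0 < a.C ∧ 0 < a.D ∧ a.D ≤ a.T

/-- The utilization of a task. -/
def U (a : SporadicTask) : ℝ := a.C / a.T

/-- The task as it appears on processors of speed `s`: execution times become `C / s`. -/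
def atSpeed (s : ℝ) (a : SporadicTask) : SporadicTask := ⟨a.C / s, a.T, a.D⟩

end SporadicTask

/-! ### Feasibility -/

/-- `r i j` is the arrival time of the `j`-th job of task `i`. An arrival pattern is legal if the
system starts at time `0` and any two consecutive jobs of the same task are separated by at least
its minimum inter-arrival time. -/
def LegalArrivals {ι : Type} (τ : ι → SporadicTask) (r : ι → ℕ → ℝ) : Prop :=
  ∀ i, 0 ≤ r i 0 ∧ ∀ j, r i j + (τ i).T ≤ r i (j + 1)

/-- A preemptive schedule (with migration allowed) on `M` unit-speed processors that meets all
deadlines. `x i j p` is the set of times at which job `j` of task `i` runs on processor `p`. -/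
structure MeetsDeadlines {ι : Type} (M : ℕ) (τ : ι → SporadicTask) (r : ι → ℕ → ℝ)
    (x : ι → ℕ → Fin M → Set ℝ) : Prop where
  measurable : ∀ i j p, MeasurableSet (x i j p)
  /-- a processor executes at most one job at a time -/
  processor : ∀ p i j i' j', (i, j) ≠ (i', j') → Disjoint (x i j p) (x i' j' p)
  /-- a job runs on at most one processor at a time -/
  sequential : ∀ i j p p', p ≠ p' → Disjoint (x i j p) (x i j p')
  /-- a job runs only between its arrival and its absolute deadline -/
  window : ∀ i j p, x i j p ⊆ Set.Icc (r i j) (r i j + (τ i).D)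
  /-- a job receives its full execution time -/
  executed : ∀ i j, ∑ p, volume (x i j p) = ENNReal.ofReal (τ i).C

/-- The task set can be feasibly scheduled (by an arbitrary policy) on `M` unit-speed identical
processors: every legal arrival pattern admits a schedule meeting all deadlines. -/
def Feasible {ι : Type} (M : ℕ) (τ : ι → SporadicTask) : Prop :=
  ∀ r, LegalArrivals τ r → ∃ x, MeetsDeadlines M τ r x

/-- The task set can be feasibly scheduled by a partitioned policy: the tasks can be assigned to
the `M` processors so that the tasks of each processor are feasible on that processor alone. -/
def PartitionedFeasible {ι : Type} (M : ℕ) (τ : ι → SporadicTask) : Prop :=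
  ∃ a : ι → Fin M, ∀ m, Feasible 1 (fun i : {i : ι // a i = m} => τ i)

/-! ### Schedulability tests for the lowest-priority task `k`, on a processor that already
holds the set `P` of higher-priority tasks -/

/-- Time-demand analysis. -/
def tdaTest {ι : Type} (τ : ι → SporadicTask) (P : Finset ι) (k : ι) : Prop :=
  ∃ t : ℝ, 0 < t ∧ t ≤ (τ k).D ∧
    (τ k).C + ∑ i ∈ P, (⌈t / (τ i).T⌉ : ℝ) * (τ i).C ≤ t

open Classical in
/-- The hyperbolic bound: tasks of `P` with period `≥ D_k` add to the execution time of task `k`,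
those with period `< D_k` contribute through their utilizations. -/
def hyperbolicTest {ι : Type} (τ : ι → SporadicTask) (P : Finset ι) (k : ι) : Prop :=
  (((τ k).C + ∑ i ∈ P.filter (fun i => (τ k).D ≤ (τ i).T), (τ i).C) / (τ k).D + 1) *
    ∏ i ∈ P.filter (fun i => (τ i).T < (τ k).D), ((τ i).U + 1) ≤ 2

/-! ### Deadline-monotonic partitioning -/

/-- `DMReachable test M τ k P`: some run of deadline-monotonic partitioning on `M` processors with
arbitrary fitting and the given schedulability test places the first `k` tasks so that processor
`m` holds the tasks `P m`. The tasks are expected to be sorted by relative deadline. The first task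
goes to the first processor; every further task goes to any processor whose test it passes. -/
inductive DMReachable {N : ℕ} (test : Finset (Fin N) → Fin N → Prop) (M : ℕ) :
    ℕ → (Fin M → Finset (Fin N)) → Prop
  | init (h : 0 < N) :
      DMReachable test M 1 (fun m => if m.val = 0 then {⟨0, h⟩} else ∅)
  | step {k : ℕ} {P : Fin M → Finset (Fin N)} (hk : k < N) (m : Fin M) :
      DMReachable test M k P → test (P m) ⟨k, hk⟩ →
      DMReachable test M (k + 1) (Function.update P m (insert ⟨k, hk⟩ (P m)))

/-- Some run with arbitrary fitting returns "no feasible schedule is found": it arrives at a task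
that passes the test on none of the `M` processors. -/
def DMCanFail {N : ℕ} (test : Finset (Fin N) → Fin N → Prop) (M : ℕ) : Prop :=
  ∃ (k : ℕ) (hk : k < N) (P : Fin M → Finset (Fin N)),
    DMReachable test M k P ∧ ∀ m, ¬ test (P m) ⟨k, hk⟩

/-- Deadline-monotonic partitioning with arbitrary fitting and schedulability test `test` has
speedup factor `ρ` on `M` processors for constrained-deadline task sets, with respect to the
reference notion of feasibility `feas`: whenever a task set (indexed by non-decreasing relative
deadlines) is feasible on `M` processors of speed `1`, no run of the algorithm on `M` processors of
speed `ρ` fails. -/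
def HasSpeedupFactor
    (feas : ∀ {N : ℕ}, ℕ → (Fin N → SporadicTask) → Prop)
    (test : ∀ {N : ℕ}, (Fin N → SporadicTask) → Finset (Fin N) → Fin N → Prop)
    (M : ℕ) (ρ : ℝ) : Prop :=
  ∀ (N : ℕ) (τ : Fin N → SporadicTask),
    (∀ i, (τ i).IsConstrained) → (Monotone fun i => (τ i).D) → feas M τ →
    ¬ DMCanFail (test (fun i => (τ i).atSpeed ρ)) M

end

/-- The earliest time at which the free time (outside `B`) since `r` amounts to `c`, if any. -/
noncomputable def fillTime (B : Set ℝ) (r c : ℝ) : ℝ :=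
  open Classical in
  if h : ∃ θ, r ≤ θ ∧ volume.real (Icc r θ \ B) = c then h.choose else r

/-- Jobs in order of `rank`, each job taking the first free `c` time units after its arrival. -/
noncomputable def greedySlots {J : Type*} (r c : J → ℝ) (rank : J → ℕ) (p : J) : Set ℝ :=
  Icc (r p) (fillTime (⋃ q, ⋃ (_ : rank q < rank p), greedySlots r c rank q) (r p) (c p)) \
    ⋃ q, ⋃ (_ : rank q < rank p), greedySlots r c rank q
termination_by rank p

/-- Time occupied by jobs of rank smaller than that of `p`. -/
noncomputable def busyBefore {J : Type*} (r c : J → ℝ) (rank : J → ℕ) (p : J) : Set ℝ :=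
  ⋃ q, ⋃ (_ : rank q < rank p), greedySlots r c rank q

theorem greedySlots_eq {J : Type*} (r c : J → ℝ) (rank : J → ℕ) (p : J) :
    greedySlots r c rank p =
      Icc (r p) (fillTime (busyBefore r c rank p) (r p) (c p)) \ busyBefore r c rank p := by
  rw [greedySlots]; rfl

theorem volume_real_Icc_diff_lipschitz (B : Set ℝ) (r : ℝ) :
    LipschitzWith 1 (fun θ => volume.real (Icc r θ \ B)) := by
  apply LipschitzWith.of_le_add
  intro x y
  have h1 : Icc r x \ B ⊆ (Icc r y \ B) ∪ Icc y x := by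
    rintro t ⟨⟨h1, h2⟩, h3⟩
    rcases le_total t y with h | h
    · exact Or.inl ⟨⟨h1, h⟩, h3⟩
    · exact Or.inr ⟨h, h2⟩
  have hfin : volume ((Icc r y \ B) ∪ Icc y x) ≠ ∞ :=
    measure_ne_top_of_subset (union_subset_union_left _ sdiff_subset)
      (measure_union_lt_top measure_Icc_lt_top measure_Icc_lt_top).ne
  calc volume.real (Icc r x \ B) ≤ volume.real ((Icc r y \ B) ∪ Icc y x) :=
        measureReal_mono h1 hfin
    _ ≤ volume.real (Icc r y \ B) + volume.real (Icc y x) := measureReal_union_le _ _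
    _ ≤ _ := by
        gcongr
        rw [Real.volume_real_Icc, Real.dist_eq]
        exact max_le (le_abs_self _) (abs_nonneg _)

theorem exists_fillTime {B : Set ℝ} {r c d : ℝ} (hc : 0 ≤ c) (hrd : r ≤ d)
    (h : c ≤ volume.real (Icc r d \ B)) : ∃ θ, r ≤ θ ∧ volume.real (Icc r θ \ B) = c := by
  have h0 : volume.real (Icc r r \ B) = 0 := by
    apply (measureReal_eq_zero_iff (measure_ne_top_of_subset sdiff_subset
      measure_Icc_lt_top.ne)).2
    exact measure_mono_null sdiff_subset (by simp)
  obtain ⟨θ, hθ, he⟩ := intermediate_value_Icc hrd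
    (volume_real_Icc_diff_lipschitz B r).continuous.continuousOn
    (show c ∈ Icc _ _ from ⟨h0.trans_le hc, h⟩)
  exact ⟨θ, hθ.1, he⟩

theorem volume_real_fillTime {B : Set ℝ} {r c d : ℝ} (hc : 0 ≤ c) (hrd : r ≤ d)
    (h : c ≤ volume.real (Icc r d \ B)) :
    volume.real (Icc r (fillTime B r c) \ B) = c := by
  have hex := exists_fillTime hc hrd h
  rw [fillTime, dif_pos hex]
  exact hex.choose_spec.2

section EDF

variable {J : Type*} {r c : J → ℝ} {rank : J → ℕ}

theorem measurableSet_greedySlots (hinj : Function.Injective rank) (p : J) :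
    MeasurableSet (greedySlots r c rank p) := by
  have : Countable J := hinj.countable
  induction hn : rank p using Nat.strong_induction_on generalizing p with
  | _ n ih =>
    rw [greedySlots_eq]
    refine measurableSet_Icc.diff ?_
    refine MeasurableSet.iUnion fun q => MeasurableSet.iUnion fun hq => ?_
    exact ih _ (hn ▸ hq) q rfl

theorem greedySlots_subset_busyBefore {p q : J} (h : rank q < rank p) :
    greedySlots r c rank q ⊆ busyBefore r c rank p :=
  fun _ ht => mem_iUnion₂.2 ⟨q, h, ht⟩

theorem disjoint_greedySlots (hinj : Function.Injective rank) {p q : J} (h : p ≠ q) :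
    Disjoint (greedySlots r c rank p) (greedySlots r c rank q) := by
  have key : ∀ p q : J, rank q < rank p →
      Disjoint (greedySlots r c rank p) (greedySlots r c rank q) := by
    intro p q hqp
    rw [greedySlots_eq r c rank p]
    exact disjoint_sdiff_left.mono_right (greedySlots_subset_busyBefore hqp)
  rcases lt_or_gt_of_ne (hinj.ne h) with hlt | hlt
  · exact (key q p hlt).symm
  · exact key p q hlt

theorem busyBefore_mono {p q : J} (h : rank q < rank p) :
    busyBefore r c rank q ⊆ busyBefore r c rank p := by
  intro t ht
  obtain ⟨u, hu, htu⟩ := mem_iUnion₂.1 ht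
  exact mem_iUnion₂.2 ⟨u, hu.trans h, htu⟩

/-- A job of smaller rank that still runs after `s` leaves no free time between its arrival
and `s`. -/
theorem volume_greedySlots_inter_Ici {p q : J} (h : rank q < rank p) {s : ℝ}
    (hne : (Icc (r q) s \ busyBefore r c rank p).Nonempty) :
    volume (greedySlots r c rank q ∩ Ici s) = 0 := by
  rw [greedySlots_eq]
  rcases le_or_gt (fillTime (busyBefore r c rank q) (r q) (c q)) s with hs | hs
  · refine measure_mono_null (t := {s}) ?_ (by simp)
    rintro t ⟨⟨⟨_, h2⟩, _⟩, h4⟩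
    exact le_antisymm (h2.trans hs) h4
  · exfalso
    obtain ⟨t, ⟨h1, h2⟩, h3⟩ := hne
    apply h3
    by_cases hB : t ∈ busyBefore r c rank q
    · exact busyBefore_mono h hB
    · apply greedySlots_subset_busyBefore h
      rw [greedySlots_eq]
      exact ⟨⟨h1, h2.trans hs.le⟩, hB⟩

theorem le_volume_free {d : J → ℝ} (hinj : Function.Injective rank)
    (hmono : ∀ p q, rank p < rank q → d p ≤ d q)
    (hdem : ∀ s t, ∀ S : Finset J, S.Nonempty → (∀ p ∈ S, s ≤ r p ∧ d p ≤ t) →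
      ∑ p ∈ S, c p ≤ t - s) (p : J)
    (ih : ∀ q, rank q < rank p → volume.real (greedySlots r c rank q) = c q) :
    c p ≤ volume.real (Icc (r p) (d p) \ busyBefore r c rank p) := by
  classical
  set B := busyBefore r c rank p with hB
  have hQfin : {q | rank q < rank p}.Finite :=
    (Set.finite_Iio (rank p)).preimage hinj.injOn
  set Q := hQfin.toFinset with hQ
  have memQ : ∀ q, q ∈ Q ↔ rank q < rank p := by simp [hQ]
  have hpQ : p ∉ Q := by simp [memQ]
  set R := (insert p Q).filter (fun q => volume (Icc (r q) (r p) \ B) = 0) with hR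
  have hpR : p ∈ R := by
    simp only [hR, Finset.mem_filter, Finset.mem_insert_self, true_and]
    exact measure_mono_null sdiff_subset (by simp)
  obtain ⟨q0, hq0, hmin⟩ := R.exists_min_image r ⟨p, hpR⟩
  set s := r q0 with hs
  have hsp : s ≤ r p := hmin p hpR
  have hfree : volume (Icc s (r p) \ B) = 0 := (Finset.mem_filter.1 hq0).2
  have hearly : ∀ q ∈ Q, r q < s → volume (greedySlots r c rank q ∩ Ici s) = 0 := by
    intro q hq hlt
    apply volume_greedySlots_inter_Ici ((memQ q).1 hq)
    by_contra hemp
    rw [Set.not_nonempty_iff_eq_empty] at hemp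
    have : q ∈ R := by
      simp only [hR, Finset.mem_filter, Finset.mem_insert, hq, or_true, true_and]
      refine measure_mono_null (t := (Icc (r q) s \ B) ∪ (Icc s (r p) \ B)) ?_ ?_
      · rintro t ⟨⟨h1, h2⟩, h3⟩
        rcases le_total t s with h | h
        · exact Or.inl ⟨⟨h1, h⟩, h3⟩
        · exact Or.inr ⟨⟨h, h2⟩, h3⟩
      · rw [hemp, Set.empty_union]; exact hfree
    exact absurd (hmin q this) (not_le.2 hlt)
  have hdemS := hdem s (d p) ((insert p Q).filter (fun q => s ≤ r q))
    ⟨p, by simp [hsp]⟩ (by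
      intro q hq
      simp only [Finset.mem_filter, Finset.mem_insert] at hq
      refine ⟨hq.2, ?_⟩
      rcases hq.1 with rfl | hq
      · exact le_rfl
      · exact hmono _ _ ((memQ q).1 hq))
  rw [Finset.filter_insert, if_pos hsp, Finset.sum_insert (by simp [hpQ])] at hdemS
  have hfin : ∀ q, volume (greedySlots r c rank q ∩ Ici s) ≠ ∞ := by
    intro q
    rw [greedySlots_eq]
    exact measure_ne_top_of_subset (inter_subset_left.trans sdiff_subset) measure_Icc_lt_top.ne
  have hcover : Icc s (d p) ⊆ (Icc s (r p) \ B) ∪ ((Icc (r p) (d p) \ B) ∪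
      ⋃ q ∈ Q, (greedySlots r c rank q ∩ Ici s)) := by
    rintro t ⟨h1, h2⟩
    by_cases hB' : t ∈ B
    · obtain ⟨u, hu, htu⟩ := mem_iUnion₂.1 hB'
      exact Or.inr (Or.inr (mem_iUnion₂.2 ⟨u, (memQ u).2 hu, htu, h1⟩))
    · rcases le_total t (r p) with h | h
      · exact Or.inl ⟨⟨h1, h⟩, hB'⟩
      · exact Or.inr (Or.inl ⟨⟨h, h2⟩, hB'⟩)
  have hUfin : volume (⋃ q ∈ Q, (greedySlots r c rank q ∩ Ici s)) ≠ ∞ :=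
    ((measure_biUnion_finset_le _ _).trans_lt
      (ENNReal.sum_lt_top.2 fun q _ => (hfin q).lt_top)).ne
  have hI1 : volume (Icc s (r p) \ B) ≠ ∞ := by rw [hfree]; simp
  have hI2 : volume (Icc (r p) (d p) \ B) ≠ ∞ :=
    measure_ne_top_of_subset sdiff_subset measure_Icc_lt_top.ne
  have hU : volume.real (⋃ q ∈ Q, (greedySlots r c rank q ∩ Ici s)) ≤
      ∑ q ∈ Q.filter (fun q => s ≤ r q), c q := by
    refine (measureReal_biUnion_finset_le _ _).trans ?_
    rw [Finset.sum_filter]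
    refine Finset.sum_le_sum fun q hq => ?_
    split_ifs with h
    · rw [← ih q ((memQ q).1 hq)]
      refine measureReal_mono inter_subset_left ?_
      rw [greedySlots_eq]
      exact measure_ne_top_of_subset sdiff_subset measure_Icc_lt_top.ne
    · rw [measureReal_def, hearly q hq (not_le.1 h)]; simp
  have h1 : volume.real (Icc s (d p)) ≤ volume.real (Icc s (r p) \ B) +
      (volume.real (Icc (r p) (d p) \ B) +
        volume.real (⋃ q ∈ Q, (greedySlots r c rank q ∩ Ici s))) := by
    refine (measureReal_mono hcover ?_).trans ((measureReal_union_le _ _).trans ?_)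
    · exact (measure_union_lt_top hI1.lt_top (measure_union_lt_top hI2.lt_top hUfin.lt_top)).ne
    · gcongr
      exact measureReal_union_le _ _
  rw [Real.volume_real_Icc, measureReal_def (s := Icc s (r p) \ B), hfree] at h1
  have h2 := le_max_left (d p - s) 0
  simp only [ENNReal.toReal_zero, zero_add] at h1
  linarith

/-- Jobs that satisfy the processor demand criterion can be scheduled on one processor. -/
theorem exists_schedule_of_demand {d : J → ℝ} (hinj : Function.Injective rank)
    (hmono : ∀ p q, rank p < rank q → d p ≤ d q) (hc : ∀ p, 0 < c p)
    (hdem : ∀ s t, ∀ S : Finset J, S.Nonempty → (∀ p ∈ S, s ≤ r p ∧ d p ≤ t) →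
      ∑ p ∈ S, c p ≤ t - s) :
    ∃ x : J → Set ℝ, (∀ p, MeasurableSet (x p)) ∧ (∀ p q, p ≠ q → Disjoint (x p) (x q)) ∧
      (∀ p, x p ⊆ Icc (r p) (d p)) ∧ ∀ p, volume (x p) = ENNReal.ofReal (c p) := by
  have hrd : ∀ p, r p ≤ d p := by
    intro p
    have := hdem (r p) (d p) {p} (by simp) (by simp)
    simp only [Finset.sum_singleton] at this
    linarith [hc p]
  have hreal : ∀ p, volume.real (greedySlots r c rank p) = c p := by
    intro p
    induction hn : rank p using Nat.strong_induction_on generalizing p with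
    | _ n ih =>
      rw [greedySlots_eq]
      exact volume_real_fillTime (hc p).le (hrd p)
        (le_volume_free hinj hmono hdem p fun q hq => ih _ (hn ▸ hq) q rfl)
  have hvol : ∀ p, volume (greedySlots r c rank p) = ENNReal.ofReal (c p) := by
    intro p
    have hne : volume (greedySlots r c rank p) ≠ ∞ := by
      rw [greedySlots_eq]
      exact measure_ne_top_of_subset sdiff_subset measure_Icc_lt_top.ne
    rw [← hreal p, ofReal_measureReal hne]
  refine ⟨fun p => greedySlots r c rank p ∩ Icc (r p) (d p), fun p =>
    (measurableSet_greedySlots hinj p).inter measurableSet_Icc, fun p q hpq =>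
    (disjoint_greedySlots hinj hpq).mono inter_subset_left inter_subset_left,
    fun p => inter_subset_right, fun p => ?_⟩
  refine le_antisymm ((measure_mono inter_subset_left).trans (hvol p).le) ?_
  have hfree := le_volume_free hinj hmono hdem p fun q _ => hreal q
  rcases le_or_gt (fillTime (busyBefore r c rank p) (r p) (c p)) (d p) with h | h
  · rw [← hvol p]
    refine measure_mono (subset_inter Subset.rfl ?_)
    rw [greedySlots_eq]
    exact sdiff_subset.trans (Icc_subset_Icc_right h)
  · have hsub : Icc (r p) (d p) \ busyBefore r c rank p ⊆
        greedySlots r c rank p ∩ Icc (r p) (d p) := by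
      rintro t ⟨h1, h2⟩
      refine ⟨?_, h1⟩
      rw [greedySlots_eq]
      exact ⟨⟨h1.1, h1.2.trans h.le⟩, h2⟩
    refine le_trans ?_ (measure_mono hsub)
    rw [ENNReal.ofReal_le_iff_le_toReal (measure_ne_top_of_subset sdiff_subset
      measure_Icc_lt_top.ne)]
    exact hfree

/-- Jobs can be ranked by deadline if only finitely many deadlines lie before any given time. -/
theorem exists_deadline_rank [Countable J] {d : J → ℝ} (hfin : ∀ x, {q | d q ≤ x}.Finite) :
    ∃ rank : J → ℕ, Function.Injective rank ∧ ∀ p q, rank p < rank q → d p ≤ d q := by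
  obtain ⟨e, he⟩ := exists_injective_nat J
  set before : J → Set J := fun p => {q | d q < d p ∨ (d q = d p ∧ e q < e p)} with hb
  have hbf : ∀ p, (before p).Finite := fun p =>
    (hfin (d p)).subset (by rintro q (h | h); exacts [h.le, h.1.le])
  have hlt : ∀ p q, q ∈ before p → (before q).ncard < (before p).ncard := by
    intro p q hq
    apply Set.ncard_lt_ncard _ (hbf p)
    refine ⟨?_, fun hsub => ?_⟩
    · rintro u hu
      rcases hq with h | h <;> rcases hu with h' | h'
      · exact Or.inl (h'.trans h)
      · exact Or.inl (h'.1 ▸ h)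
      · exact Or.inl (h.1 ▸ h')
      · exact Or.inr ⟨h'.1.trans h.1, h'.2.trans h.2⟩
    · rcases hsub hq with h | h
      · exact lt_irrefl _ h
      · exact lt_irrefl _ h.2
  have htri : ∀ p q, p ≠ q → q ∈ before p ∨ p ∈ before q := by
    intro p q hpq
    rcases lt_trichotomy (d p) (d q) with h | h | h
    · exact Or.inr (Or.inl h)
    · rcases lt_or_gt_of_ne (he.ne hpq) with h' | h'
      · exact Or.inr (Or.inr ⟨h, h'⟩)
      · exact Or.inl (Or.inr ⟨h.symm, h'⟩)
    · exact Or.inl (Or.inl h)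
  refine ⟨fun p => (before p).ncard, fun p q hpq => ?_, fun p q hpq => ?_⟩
  · by_contra hne
    rcases htri p q hne with h | h
    · exact absurd hpq (hlt _ _ h).ne'
    · exact absurd hpq (hlt _ _ h).ne
  · by_contra hne
    exact absurd (hlt p q (Or.inl (not_le.1 hne))) (not_lt.2 hpq.le)

end EDF

/-- The demand bound function of a sporadic task. -/
noncomputable def SporadicTask.demand (a : SporadicTask) (L : ℝ) : ℝ :=
  if a.D ≤ L then (⌊(L - a.D) / a.T⌋₊ + 1) * a.C else 0

theorem LegalArrivals.add_mul_le {ι : Type} {τ : ι → SporadicTask} {r : ι → ℕ → ℝ}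
    (h : LegalArrivals τ r) (i : ι) (j k : ℕ) : r i j + k * (τ i).T ≤ r i (j + k) := by
  induction k with
  | zero => simp
  | succ k ih =>
    have := (h i).2 (j + k)
    rw [← add_assoc]
    push_cast
    linarith

theorem LegalArrivals.card_mul_le_demand {ι : Type} {τ : ι → SporadicTask} {r : ι → ℕ → ℝ}
    (h : LegalArrivals τ r) {i : ι} (hi : (τ i).IsConstrained) {s t : ℝ} (F : Finset ℕ)
    (hF : ∀ j ∈ F, s ≤ r i j ∧ r i j + (τ i).D ≤ t) :
    F.card * (τ i).C ≤ (τ i).demand (t - s) := by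
  obtain ⟨hC, hD, hDT⟩ := hi
  rw [SporadicTask.demand]
  rcases F.eq_empty_or_nonempty with rfl | hne
  · simp only [Finset.card_empty, Nat.cast_zero, zero_mul]
    split_ifs <;> positivity
  · have h0 := hF _ (F.min'_mem hne)
    have h1 := hF _ (F.max'_mem hne)
    have hle : F.min' hne ≤ F.max' hne := F.min'_le _ (F.max'_mem hne)
    obtain ⟨k, hk⟩ := Nat.exists_eq_add_of_le hle
    have hsep := h.add_mul_le i (F.min' hne) k
    rw [← hk] at hsep
    have hT : 0 < (τ i).T := hD.trans_le hDT
    have hk0 : 0 ≤ (k : ℝ) * (τ i).T := by positivity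
    rw [if_pos (by linarith)]
    gcongr
    have hcard : F.card ≤ k + 1 := by
      have hsub : F ⊆ Finset.Icc (F.min' hne) (F.max' hne) := fun j hj =>
        Finset.mem_Icc.2 ⟨F.min'_le _ hj, F.le_max' _ hj⟩
      have := Finset.card_le_card hsub
      rw [Nat.card_Icc] at this
      omega
    have hfl : k ≤ ⌊(t - s - (τ i).D) / (τ i).T⌋₊ := by
      apply Nat.le_floor
      rw [le_div_iff₀ hT]
      linarith
    exact_mod_cast hcard.trans (by omega)

theorem feasible_one_of_demand {ι : Type} [Fintype ι] {τ : ι → SporadicTask}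
    (hτ : ∀ i, (τ i).IsConstrained) (hdem : ∀ L, 0 ≤ L → ∑ i, (τ i).demand L ≤ L) :
    Feasible 1 τ := by
  classical
  intro r hr
  have hT : ∀ i, 0 < (τ i).T := fun i => (hτ i).2.1.trans_le (hτ i).2.2
  have hfin : ∀ x, {q : ι × ℕ | r q.1 q.2 + (τ q.1).D ≤ x}.Finite := by
    intro x
    refine Set.Finite.subset (Set.finite_iUnion fun i : ι =>
      (Set.finite_Iic ⌊x / (τ i).T⌋₊).image fun j => (i, j)) ?_
    rintro ⟨i, j⟩ hq
    simp only [mem_ofPred_eq] at hq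
    refine mem_iUnion.2 ⟨i, j, Nat.le_floor ?_, rfl⟩
    rw [le_div_iff₀ (hT i)]
    have := hr.add_mul_le i 0 j
    rw [zero_add] at this
    linarith [(hr i).1, (hτ i).2.1]
  obtain ⟨rank, hinj, hmono⟩ := exists_deadline_rank hfin
  obtain ⟨x, hx1, hx2, hx3, hx4⟩ := exists_schedule_of_demand
    (r := fun q : ι × ℕ => r q.1 q.2) (c := fun q => (τ q.1).C) hinj hmono
    (fun q => (hτ q.1).1) (by
      intro s t S hS hSt
      have hst : 0 ≤ t - s := by
        obtain ⟨q, hq⟩ := hS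
        have := hSt q hq
        linarith [(hτ q.1).2.1]
      refine le_trans ?_ (hdem _ hst)
      rw [← Finset.sum_fiberwise S Prod.fst]
      refine Finset.sum_le_sum fun i _ => ?_
      have hinjF : Set.InjOn Prod.snd (S.filter (fun q => q.1 = i) : Set (ι × ℕ)) := by
        rintro ⟨i1, j1⟩ h1 ⟨i2, j2⟩ h2 h
        simp only [Finset.coe_filter, mem_ofPred_eq] at h1 h2 h
        rw [h1.2, h2.2, h]
      have := hr.card_mul_le_demand (hτ i) (s := s) (t := t)
        ((S.filter (fun q => q.1 = i)).image Prod.snd) (by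
          intro j hj
          simp only [Finset.mem_image, Finset.mem_filter] at hj
          obtain ⟨q, ⟨hq, rfl⟩, rfl⟩ := hj
          exact hSt q hq)
      rw [Finset.card_image_of_injOn hinjF] at this
      refine le_trans (le_of_eq ?_) this
      rw [← nsmul_eq_mul, ← Finset.sum_const]
      exact Finset.sum_congr rfl fun q hq => by rw [(Finset.mem_filter.1 hq).2])
  refine ⟨fun i j _ => x (i, j), fun i j _ => hx1 _, fun _ i j i' j' h => hx2 _ _ h,
    fun i j p p' h => absurd (Subsingleton.elim p p') h, fun i j _ => hx3 _, fun i j => ?_⟩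
  simp [hx4]

theorem PartitionedFeasible.feasible {ι : Type} {M : ℕ} {τ : ι → SporadicTask}
    (h : PartitionedFeasible M τ) : Feasible M τ := by
  classical
  obtain ⟨a, ha⟩ := h
  intro r hr
  choose y hy using fun m => ha m (fun i => r i) (fun i => hr i)
  refine ⟨fun i j p => if hp : a i = p then y p ⟨i, hp⟩ j 0 else ∅, ?_, ?_, ?_, ?_, ?_⟩
  · intro i j p
    split_ifs with hp
    · exact (hy p).measurable _ _ _
    · exact MeasurableSet.empty
  · intro p i j i' j' hne
    split_ifs with h1 h2
    · apply (hy p).processor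
      simpa [Prod.ext_iff] using hne
    all_goals simp
  · intro i j p p' hne
    split_ifs with h1 h2
    · exact absurd (h1.symm.trans h2) hne
    all_goals simp
  · intro i j p
    split_ifs with hp
    · exact (hy p).window ⟨i, hp⟩ j 0
    · simp
  · intro i j
    rw [Finset.sum_eq_single (a i)]
    · rw [dif_pos rfl]
      simpa using (hy (a i)).executed ⟨i, rfl⟩ j
    · intro p _ hp
      rw [dif_neg hp.symm]
      simp
    · simp

theorem lambertW_half_spec :
    lambertW (1 / 2) * Real.exp (lambertW (1 / 2)) = 1 / 2 ∧ 0 ≤ lambertW (1 / 2) :=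
  (lambertW_eq_iff (by norm_num) _).2 rfl

theorem lt_lambertW {z v : ℝ} (hz : 0 ≤ z) (h : v * Real.exp v < z) : v < lambertW z := by
  obtain ⟨hw, hw0⟩ := (lambertW_eq_iff hz _).2 rfl
  by_contra hle
  have hle := not_lt.1 hle
  have := mul_le_mul hle (Real.exp_le_exp.2 hle) (Real.exp_pos _).le (hw0.trans hle)
  linarith

theorem lambertW_lt {z v : ℝ} (hz : 0 ≤ z) (h : z < v * Real.exp v) :
    lambertW z < v := by
  obtain ⟨hw, hw0⟩ := (lambertW_eq_iff hz _).2 rfl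
  by_contra hle
  have hle := not_lt.1 hle
  have := mul_le_mul hle (Real.exp_le_exp.2 hle) (Real.exp_pos _).le hw0
  linarith

theorem lambertW_half_gt : 1 / 2.843065 < lambertW (1 / 2) := by
  apply lt_lambertW (by norm_num)
  have h := Real.exp_bound' (x := 1 / 2.843065) (by norm_num) (by norm_num) (n := 10) (by norm_num)
  refine lt_of_le_of_lt (mul_le_mul_of_nonneg_left h (by norm_num)) ?_
  norm_num [Finset.sum_range_succ, Nat.factorial]

theorem lambertW_half_lt : lambertW (1 / 2) < 1 / 2.843055 := by
  apply lambertW_lt (by norm_num)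
  have h := Real.sum_le_exp_of_nonneg (x := 1 / 2.843055) (by norm_num) 10
  refine lt_of_lt_of_le ?_ (mul_le_mul_of_nonneg_left h (by norm_num))
  norm_num [Finset.sum_range_succ, Nat.factorial]

theorem abs_inv_lambertW_half_sub_lt : |1 / lambertW (1 / 2) - 2.84306| < 0.000005 := by
  have h1 := lambertW_half_gt
  have h2 := lambertW_half_lt
  have h0 : 0 < lambertW (1 / 2) := lt_trans (by norm_num) h1
  have h3 : 1 / lambertW (1 / 2) < 2.843065 := by
    rw [div_lt_comm₀ h0 (by norm_num)]; exact h1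
  have h4 : 2.843055 < 1 / lambertW (1 / 2) := by
    rw [lt_div_comm₀ (by norm_num) h0]; exact h2
  rw [abs_lt]
  constructor <;> norm_num at * <;> linarith

theorem log_two_mul_lambertW_half : Real.log (2 * lambertW (1 / 2)) = -lambertW (1 / 2) := by
  have h := lambertW_half_spec.1
  have : 2 * lambertW (1 / 2) = Real.exp (-lambertW (1 / 2)) := by
    rw [Real.exp_neg]
    exact eq_inv_of_mul_eq_one_left (by linarith)
  rw [this, Real.log_exp]

theorem inv_le_log_sub_log {j : ℕ} (hj : 0 < j) :
    1 / (j : ℝ) ≤ Real.log (j + 1 / 2) - Real.log (j - 1 / 2) := by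
  have hj1 : (1 : ℝ) ≤ j := by exact_mod_cast hj
  obtain ⟨y, hy⟩ : ∃ y : ℝ, (j : ℝ) = y + 1 / 2 := ⟨j - 1 / 2, by ring⟩
  have hy0 : 0 < y := by linarith
  have h := Real.le_log_one_add_of_nonneg (x := 1 / y) (by positivity)
  rw [hy, add_sub_cancel_right, ← Real.log_div (by positivity) hy0.ne']
  have e1 : 1 + 1 / y = (y + 1 / 2 + 1 / 2) / y := by
    field_simp; ring
  have e2 : 2 * (1 / y) / (1 / y + 2) = 1 / (y + 1 / 2) := by
    field_simp; ring
  rwa [e1, e2] at h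

theorem sum_min_le {a L : ℝ} (hL : 0 ≤ L) {q J : ℕ} (hqJ : q ≤ J) :
    ∑ j ∈ Finset.Icc 1 J, min (L / j - a) (1 - a) ≤
      q * (1 - a) - a * (J - q) + L * (Real.log (J + 1 / 2) - Real.log (q + 1 / 2)) := by
  induction J, hqJ using Nat.le_induction with
  | base =>
    have : ∑ j ∈ Finset.Icc 1 q, min (L / j - a) (1 - a) ≤ ∑ j ∈ Finset.Icc 1 q, (1 - a) :=
      Finset.sum_le_sum fun j _ => min_le_right _ _
    simp only [Finset.sum_const, Nat.card_Icc, nsmul_eq_mul, Nat.add_sub_cancel] at this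
    linarith
  | succ J hJ ih =>
    rw [Finset.sum_Icc_succ_top (by omega)]
    have h1 := inv_le_log_sub_log (Nat.succ_pos J)
    have h2 := mul_le_mul_of_nonneg_left h1 hL
    have h3 := min_le_left (L / ((J + 1 : ℕ) : ℝ) - a) (1 - a)
    rw [mul_one_div] at h2
    push_cast at *
    have e : (J : ℝ) + 1 - 1 / 2 = J + 1 / 2 := by ring
    rw [e] at h2
    linarith

theorem log_le_half_sub_inv {z : ℝ} (hz : 1 ≤ z) : Real.log z ≤ (z - z⁻¹) / 2 := by
  rw [← Real.sinh_log (by linarith)]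
  exact Real.self_le_sinh_iff.2 (Real.log_nonneg hz)

/-- With `B = q + 1/2` for `q = ⌊L⌋`, the second-order error of `log` at `L / B`. -/
theorem mul_log_div_le {L B : ℝ} (hL : 1.406 ≤ L) (hB : 1.5 ≤ B) (h : |L - B| ≤ 1 / 2) :
    L * Real.log (L / B) ≤ L - B + 0.087 := by
  have hL0 : 0 < L := by linarith
  have hB0 : 0 < B := by linarith
  obtain ⟨h1, h2⟩ := abs_le.1 h
  rcases le_total B L with hle | hle
  · have h3 := mul_le_mul_of_nonneg_left (log_le_half_sub_inv ((one_le_div hB0).2 hle)) hL0.le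
    refine h3.trans ?_
    have e : L * ((L / B - (L / B)⁻¹) / 2) = L - B + (L - B) ^ 2 / (2 * B) := by
      field_simp; ring
    rw [e]
    have : (L - B) ^ 2 / (2 * B) ≤ 0.087 := by
      rw [div_le_iff₀ (by positivity)]
      nlinarith
    linarith
  · have h3 := Real.le_log_one_add_of_nonneg (x := B / L - 1)
      (by rw [sub_nonneg]; exact (one_le_div hL0).2 hle)
    have h4 : Real.log (L / B) = - Real.log (B / L) := by rw [← Real.log_inv, inv_div]
    rw [add_sub_cancel] at h3
    have h5 := mul_le_mul_of_nonneg_left h3 hL0.le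
    have e : L * (2 * (B / L - 1) / (B / L - 1 + 2)) = B - L - (B - L) ^ 2 / (B + L) := by
      have : B / L - 1 + 2 ≠ 0 := by
        have : 0 < B / L := by positivity
        linarith
      field_simp; ring
    rw [e] at h5
    have : (B - L) ^ 2 / (B + L) ≤ 0.087 := by
      rw [div_le_iff₀ (by positivity)]
      nlinarith
    rw [h4]
    linarith

/-- The demand of periods uniformly distributed over `[2w, 1]`, where `w = W(1/2)`. -/
theorem sum_min_le_lambertW {w L : ℝ} (hw1 : 1 / 2.843065 < w) (hw2 : w < 1 / 2.843055)
    (hlog : Real.log (2 * w) = -w) (hL : 0 ≤ L) :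
    ∑ j ∈ Finset.Icc 1 ⌊L / (2 * w)⌋₊, min (L / j - 2 * w) (1 - 2 * w) +
      (if 1 ≤ L then 3 * w - 1 else 0) ≤ w * L := by
  norm_num at hw1 hw2
  have hw0 : 0 < 2 * w := by linarith
  set J := ⌊L / (2 * w)⌋₊ with hJ
  rcases lt_or_ge L (2 * w) with h1 | h1
  · have : J = 0 := Nat.floor_eq_zero.2 ((div_lt_one hw0).2 h1)
    rw [this, if_neg (by linarith)]
    simp only [zero_lt_one, Finset.Icc_eq_empty_of_lt, Finset.sum_empty]
    nlinarith
  rcases lt_or_ge L (2 * (2 * w)) with h2 | h2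
  · have : J = 1 := by
      rw [hJ, Nat.floor_eq_iff (by positivity)]
      constructor
      · rw [le_div_iff₀ hw0]; simpa using h1
      · rw [div_lt_iff₀ hw0]; norm_num; linarith
    rw [this]
    simp only [Finset.Icc_self, Finset.sum_singleton, Nat.cast_one, div_one]
    split_ifs with h3
    · have := min_le_right (L - 2 * w) (1 - 2 * w)
      nlinarith
    · have := min_le_left (L - 2 * w) (1 - 2 * w)
      nlinarith
  rw [if_pos (by linarith)]
  set q := ⌊L⌋₊ with hq
  have hqJ : q ≤ J := Nat.floor_le_floor (by rw [le_div_iff₀ hw0]; nlinarith)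
  have hq1 : 1 ≤ q := Nat.le_floor (by push_cast; linarith)
  have hq1' : (1 : ℝ) ≤ q := by exact_mod_cast hq1
  have hqL : (q : ℝ) ≤ L := Nat.floor_le hL
  have hLq : L < q + 1 := Nat.lt_floor_add_one L
  refine (add_le_add_left (sum_min_le hL hqJ) _).trans ?_
  have hB := mul_log_div_le (L := L) (B := q + 1 / 2) (by linarith) (by linarith)
    (by rw [abs_le]; constructor <;> linarith)
  have hJ0 : (0 : ℝ) ≤ J := by positivity
  have hA : 0 < 2 * w * (J + 1 / 2) := by positivity
  have hL0 : 0 < L := by linarith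
  have hA1 := mul_le_mul_of_nonneg_left
    (Real.log_le_sub_one_of_pos (div_pos hA hL0)) hL0.le
  have e1 : L * (2 * w * (J + 1 / 2) / L - 1) = 2 * w * (J + 1 / 2) - L := by field_simp
  rw [e1, Real.log_div hA.ne' hL0.ne', Real.log_mul hw0.ne' (by positivity), hlog] at hA1
  rw [Real.log_div hL0.ne' (by positivity)] at hB
  nlinarith

/-- Layered count of the jobs of tasks with equidistant periods. -/
theorem sum_floor_mul_le {a h L : ℝ} {n : ℕ} (ha : 0 < a) (hh : 0 < h) (hn : n * h = 1 - a)
    (hL : 0 ≤ L) :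
    ∑ i ∈ Finset.range n, (⌊L / (a + i * h)⌋₊ : ℝ) * h ≤
      ∑ j ∈ Finset.Icc 1 ⌊L / a⌋₊, min (L / j - a) (1 - a) + L / a * h := by
  set J := ⌊L / a⌋₊ with hJ
  have hT : ∀ i : ℕ, 0 < a + i * h := fun i => by positivity
  have hfl : ∀ i : ℕ, (⌊L / (a + i * h)⌋₊ : ℝ) =
      ∑ j ∈ Finset.Icc 1 J, if j * (a + i * h) ≤ L then (1 : ℝ) else 0 := by
    intro i
    rw [← Finset.sum_filter, Finset.sum_const, nsmul_eq_mul, mul_one]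
    congr 1
    have : (Finset.Icc 1 J).filter (fun j : ℕ => (j : ℝ) * (a + i * h) ≤ L) =
        Finset.Icc 1 ⌊L / (a + i * h)⌋₊ := by
      ext j
      simp only [Finset.mem_filter, Finset.mem_Icc]
      constructor
      · rintro ⟨⟨h1, -⟩, h2⟩
        exact ⟨h1, Nat.le_floor ((le_div_iff₀ (hT i)).2 h2)⟩
      · rintro ⟨h1, h2⟩
        refine ⟨⟨h1, h2.trans (Nat.floor_le_floor ?_)⟩, ?_⟩
        · gcongr
          have : 0 ≤ (i : ℝ) * h := by positivity
          linarith
        · rw [← le_div_iff₀ (hT i)]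
          exact (Nat.le_floor_iff (div_nonneg hL (hT i).le)).1 h2
    rw [this, Nat.card_Icc, Nat.add_sub_cancel]
  simp_rw [hfl, Finset.sum_mul]
  rw [Finset.sum_comm]
  have hlayer : ∀ j ∈ Finset.Icc 1 J, ∑ i ∈ Finset.range n,
      (if (j : ℝ) * (a + i * h) ≤ L then (1 : ℝ) else 0) * h ≤
        min (L / j - a) (1 - a) + h := by
    intro j hj
    rw [Finset.mem_Icc] at hj
    have hj0 : (0 : ℝ) < j := by exact_mod_cast hj.1
    have hjL : a ≤ L / j := by
      have h1 : (j : ℝ) ≤ L / a := (Nat.le_floor_iff (by positivity)).1 hj.2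
      rw [le_div_iff₀ ha] at h1
      rw [le_div_iff₀ hj0]
      linarith
    rw [← Finset.sum_mul, ← Finset.sum_filter, Finset.sum_const, nsmul_eq_mul, mul_one]
    set F := (Finset.range n).filter (fun i : ℕ => (j : ℝ) * (a + i * h) ≤ L) with hF
    rw [← min_add_add_right, le_min_iff]
    constructor
    · have hsub : F ⊆ Finset.range (⌊(L / j - a) / h⌋₊ + 1) := by
        intro i hi
        rw [Finset.mem_range, Nat.lt_succ_iff]
        apply Nat.le_floor
        rw [le_div_iff₀ hh, le_sub_iff_add_le, le_div_iff₀ hj0]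
        have := (Finset.mem_filter.1 hi).2
        linarith
      have hc := Finset.card_le_card hsub
      rw [Finset.card_range] at hc
      have hc' : (F.card : ℝ) ≤ ⌊(L / j - a) / h⌋₊ + 1 := by exact_mod_cast hc
      have hfle := Nat.floor_le (div_nonneg (sub_nonneg.2 hjL) hh.le)
      rw [le_div_iff₀ hh] at hfle
      nlinarith
    · have hc : (F.card : ℝ) ≤ n := by
        exact_mod_cast (Finset.card_filter_le _ _).trans_eq (Finset.card_range n)
      nlinarith
  refine (Finset.sum_le_sum hlayer).trans ?_
  rw [Finset.sum_add_distrib, Finset.sum_const, Nat.card_Icc, Nat.add_sub_cancel, nsmul_eq_mul]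
  have : (J : ℝ) ≤ L / a := Nat.floor_le (by positivity)
  gcongr

theorem demand_of_implicit {C T L : ℝ} (hT : 0 < T) :
    SporadicTask.demand ⟨C, T, T⟩ L = ⌊L / T⌋₊ * C := by
  rw [SporadicTask.demand]
  split_ifs with h
  · simp only at h ⊢
    have : ⌊L / T⌋₊ = ⌊(L - T) / T⌋₊ + 1 := by
      rw [← Nat.floor_add_one (div_nonneg (sub_nonneg.2 h) hT.le)]
      congr 1
      field_simp; ring
    rw [this]; push_cast; ring
  · simp only [not_le] at h
    rw [Nat.floor_eq_zero.2 ((div_lt_one hT).2 h)]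
    simp

theorem demand_le_of_nonneg {a : SporadicTask} (hC : 0 ≤ a.C) (hT : 0 < a.T) (hD : 0 ≤ a.D)
    {L : ℝ} : a.demand L ≤ if a.D ≤ L then (L / a.T + 1) * a.C else 0 := by
  rw [SporadicTask.demand]
  split_ifs with h
  · have : (⌊(L - a.D) / a.T⌋₊ : ℝ) ≤ L / a.T := by
      refine (Nat.floor_le (div_nonneg (sub_nonneg.2 h) hT.le)).trans ?_
      gcongr
      linarith
    gcongr
  · exact le_rfl

section Tests

variable {ι : Type} {τ : ι → SporadicTask} {P : Finset ι} {k : ι} {a : ℝ}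

theorem tdaTest_of_sum_le (ha : 0 < a) (hT : ∀ i ∈ P, a ≤ (τ i).T) (hC : ∀ i ∈ P, 0 ≤ (τ i).C)
    (hk : a ≤ (τ k).D) (hsum : (τ k).C + ∑ i ∈ P, (τ i).C ≤ a) : tdaTest τ P k := by
  refine ⟨a, ha, hk, le_trans ?_ hsum⟩
  gcongr with i hi
  have : (⌈a / (τ i).T⌉ : ℝ) ≤ 1 := by
    have : ⌈a / (τ i).T⌉ ≤ 1 := Int.ceil_le.2 (by
      rw [Int.cast_one, div_le_one (ha.trans_le (hT i hi))]; exact hT i hi)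
    exact_mod_cast this
  exact mul_le_of_le_one_left (hC i hi) this

theorem hyperbolicTest_of_sum_le (ha : 0 < a) (hT : ∀ i ∈ P, a ≤ (τ i).T)
    (hC : ∀ i ∈ P, 0 ≤ (τ i).C) (hkC : 0 ≤ (τ k).C)
    (hk : a ≤ (τ k).D) (hsum : (τ k).C + ∑ i ∈ P, (τ i).C ≤ a / 2) : hyperbolicTest τ P k := by
  classical
  rw [hyperbolicTest]
  set S := (τ k).C + ∑ i ∈ P.filter (fun i => (τ k).D ≤ (τ i).T), (τ i).C with hS
  set S' := ∑ i ∈ P.filter (fun i => (τ i).T < (τ k).D), (τ i).C with hS'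
  have hS0 : 0 ≤ S := add_nonneg hkC (Finset.sum_nonneg fun i hi => hC i (Finset.mem_filter.1 hi).1)
  have htot : S + S' ≤ a / 2 := by
    rw [hS, hS', add_assoc, ← Finset.sum_filter_add_sum_filter_not P (fun i => (τ k).D ≤ (τ i).T)]
      at *
    simpa only [not_le] using hsum
  have h1 : S / (τ k).D + 1 ≤ Real.exp (S / a) := by
    refine le_trans ?_ (Real.add_one_le_exp _)
    gcongr
  have h2 : ∏ i ∈ P.filter (fun i => (τ i).T < (τ k).D), ((τ i).U + 1) ≤ Real.exp (S' / a) := by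
    rw [hS', Finset.sum_div, Real.exp_sum]
    refine Finset.prod_le_prod (fun i hi => ?_) (fun i hi => ?_)
    all_goals
      have hi' := (Finset.mem_filter.1 hi).1
      have hT' := hT i hi'
      have hC' := hC i hi'
      have : 0 < (τ i).T := ha.trans_le hT'
      rw [SporadicTask.U]
    · positivity
    · refine le_trans ?_ (Real.add_one_le_exp _)
      gcongr
  have hD : 0 < (τ k).D := ha.trans_le hk
  calc _ ≤ Real.exp (S / a) * Real.exp (S' / a) :=
      mul_le_mul h1 h2 (Finset.prod_nonneg fun i hi => by
        have hi' := (Finset.mem_filter.1 hi).1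
        exact add_nonneg (div_nonneg (hC i hi') (ha.le.trans (hT i hi'))) zero_le_one)
        (Real.exp_pos _).le
    _ = Real.exp ((S + S') / a) := by rw [← Real.exp_add, ← add_div]
    _ ≤ Real.exp (1 / 2) := by
      rw [Real.exp_le_exp, div_le_iff₀ ha]
      linarith
    _ ≤ 2 := by
      have h := Real.exp_one_lt_d9
      have e : Real.exp (1 / 2) * Real.exp (1 / 2) = Real.exp 1 := by
        rw [← Real.exp_add]; norm_num
      nlinarith [Real.exp_pos (1 / 2)]

end Tests

/-- A run that places all tasks but the last one according to `asg`. -/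
theorem DMCanFail.of_assignment {N M : ℕ} {test : Finset (Fin (N + 1)) → Fin (N + 1) → Prop}
    (asg : Fin N → Fin M) (hN : 0 < N) (h0 : (asg ⟨0, hN⟩).val = 0)
    (hpass : ∀ k : Fin N, ∀ P : Finset (Fin N), (∀ i ∈ P, i < k ∧ asg i = asg k) →
      test (P.map Fin.castSuccEmb) k.castSucc)
    (hfail : ∀ m, ¬ test ((Finset.univ.filter (fun i => asg i = m)).map Fin.castSuccEmb)
      (Fin.last N)) : DMCanFail test M := by
  classical
  set placed : ℕ → Fin M → Finset (Fin (N + 1)) := fun k m =>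
    (Finset.univ.filter (fun i : Fin N => i.val < k ∧ asg i = m)).map Fin.castSuccEmb with hp
  have hreach : ∀ k, 1 ≤ k → k ≤ N → DMReachable test M k (placed k) := by
    intro k hk
    induction k, hk using Nat.le_induction with
    | base =>
      intro _
      convert DMReachable.init (test := test) (M := M) (Nat.succ_pos N) using 1
      funext m
      have hzero : ∀ i : Fin N, i.val < 1 ↔ i = ⟨0, hN⟩ := fun i => by
        rw [Fin.ext_iff]; simp
      split_ifs with hm
      · ext i
        simp only [hp, hzero, Finset.mem_map, Finset.mem_filter, Finset.mem_univ, true_and,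
          Finset.mem_singleton]
        constructor
        · rintro ⟨i, ⟨rfl, -⟩, rfl⟩; rfl
        · rintro rfl
          exact ⟨⟨0, hN⟩, ⟨rfl, Fin.ext (h0.trans hm.symm)⟩, rfl⟩
      · ext i
        simp only [hp, hzero, Finset.mem_map, Finset.mem_filter, Finset.mem_univ, true_and,
          Finset.notMem_empty, iff_false]
        rintro ⟨i, ⟨rfl, h⟩, -⟩
        exact hm (h ▸ h0)
    | succ k hk ih =>
      intro hkN
      have hkN' : k < N := hkN
      have hstep := DMReachable.step (Nat.lt_succ_of_lt hkN') (asg ⟨k, hkN'⟩)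
        (ih hkN'.le) (hpass ⟨k, hkN'⟩ _ (by
          intro i hi
          exact (Finset.mem_filter.1 hi).2))
      convert hstep using 1
      funext m
      have hsucc : ∀ i : Fin N, i.val < k + 1 ↔ i.val < k ∨ i = ⟨k, hkN'⟩ := fun i => by
        rw [Fin.ext_iff]; simp only; omega
      rcases eq_or_ne m (asg ⟨k, hkN'⟩) with rfl | hm
      · rw [Function.update_self]
        ext i
        simp only [hp, hsucc, Finset.mem_map, Finset.mem_filter, Finset.mem_univ, true_and,
          Finset.mem_insert]
        constructor
        · rintro ⟨i, ⟨h | rfl, h'⟩, rfl⟩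
          · exact Or.inr ⟨i, ⟨h, h'⟩, rfl⟩
          · exact Or.inl rfl
        · rintro (rfl | ⟨i, ⟨h, h'⟩, rfl⟩)
          · exact ⟨⟨k, hkN'⟩, ⟨Or.inr rfl, rfl⟩, rfl⟩
          · exact ⟨i, ⟨Or.inl h, h'⟩, rfl⟩
      · rw [Function.update_of_ne hm]
        simp only [hp, hsucc]
        congr 1
        ext i
        simp only [Finset.mem_filter, Finset.mem_univ, true_and]
        constructor
        · rintro ⟨h | rfl, h'⟩
          · exact ⟨h, h'⟩
          · exact absurd h'.symm hm
        · rintro ⟨h, h'⟩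
          exact ⟨Or.inl h, h'⟩
  refine ⟨N, Nat.lt_succ_self N, placed N, hreach N hN le_rfl, fun m => ?_⟩
  have : placed N m = (Finset.univ.filter (fun i => asg i = m)).map Fin.castSuccEmb := by
    simp [hp]
  rw [this]
  exact hfail m

/-- Enumeration of `M * K` copies of each of `n` types, type by type. -/
def copyEquiv (n M K : ℕ) : Fin n × (Fin M × Fin K) ≃ Fin (n * (M * K)) :=
  (Equiv.prodCongr (Equiv.refl _) finProdFinEquiv).trans finProdFinEquiv

theorem copyEquiv_symm_fst_monotone (n M K : ℕ) :
    Monotone fun i => ((copyEquiv n M K).symm i).1 := by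
  intro i j hij
  exact Nat.div_le_div_right (Fin.le_def.1 hij)

theorem copyEquiv_symm_zero {n M K : ℕ} (h : 0 < n * (M * K)) :
    (((copyEquiv n M K).symm ⟨0, h⟩).2.1).val = 0 := by
  change (0 % (M * K)) / K = 0
  simp

@[to_additive]
theorem prod_copyEquiv {n M K : ℕ} {β : Type*} [CommMonoid β] (φ : Fin n → β)
    (p : Fin M × Fin K → Prop) [DecidablePred p] :
    ∏ i with p ((copyEquiv n M K).symm i).2, φ ((copyEquiv n M K).symm i).1 =
      ∏ t, φ t ^ (Finset.univ.filter p).card := by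
  rw [Finset.prod_filter, Equiv.prod_comp (copyEquiv n M K).symm
    (fun x => if p x.2 then φ x.1 else 1), Fintype.prod_prod_type]
  refine Finset.prod_congr rfl fun t _ => ?_
  simp only
  rw [← Finset.prod_filter, Finset.prod_const]

theorem card_filter_fst_eq {M K : ℕ} (m : Fin M) :
    (Finset.univ.filter (fun x : Fin M × Fin K => x.1 = m)).card = K := by
  have : Finset.univ.filter (fun x : Fin M × Fin K => x.1 = m) = {m} ×ˢ Finset.univ := by
    ext x; simp only [Finset.mem_filter, Finset.mem_product, Finset.mem_singleton, Finset.mem_univ,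
      true_and, and_true]
  rw [this, Finset.card_product]; simp

theorem card_filter_snd_eq {M K : ℕ} (j : Fin K) :
    (Finset.univ.filter (fun x : Fin M × Fin K => x.2 = j)).card = M := by
  have : Finset.univ.filter (fun x : Fin M × Fin K => x.2 = j) = Finset.univ ×ˢ {j} := by
    ext x; simp only [Finset.mem_filter, Finset.mem_product, Finset.mem_singleton, Finset.mem_univ,
      true_and]
  rw [this, Finset.card_product]; simp

/-- The task with its execution time multiplied by `c`. -/
noncomputable def SporadicTask.scale (c : ℝ) (a : SporadicTask) : SporadicTask :=
  ⟨c * a.C, a.T, a.D⟩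

theorem SporadicTask.demand_scale (c : ℝ) (a : SporadicTask) (L : ℝ) :
    (a.scale c).demand L = c * a.demand L := by
  by_cases h : a.D ≤ L
  · rw [demand, demand, if_pos (show (a.scale c).D ≤ L from h), if_pos h]
    simp only [scale]
    ring
  · rw [demand, demand, if_neg (show ¬ (a.scale c).D ≤ L from h), if_neg h, mul_zero]

/-- `M * K` scaled copies of each task type, followed by one task that fills a unit-speed
processor. -/
noncomputable def copiesAndOne {n : ℕ} (M K : ℕ) (c : ℝ) (σ : Fin n → SporadicTask) :
    Fin (n * (M * K) + 1) → SporadicTask :=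
  Fin.snoc (α := fun _ => SporadicTask)
    (fun i => (σ ((copyEquiv n M K).symm i).1).scale c) ⟨1, 1, 1⟩

section Copies

variable {n M K : ℕ} {c : ℝ} {σ : Fin n → SporadicTask}

theorem copiesAndOne_castSucc (i : Fin (n * (M * K))) :
    copiesAndOne M K c σ i.castSucc = (σ ((copyEquiv n M K).symm i).1).scale c := by
  simp [copiesAndOne]

theorem copiesAndOne_last : copiesAndOne M K c σ (Fin.last _) = ⟨1, 1, 1⟩ := by
  simp [copiesAndOne]

theorem copiesAndOne_isConstrained (hc : 0 < c) (hσ : ∀ t, (σ t).IsConstrained) (i) :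
    (copiesAndOne M K c σ i).IsConstrained := by
  induction i using Fin.lastCases with
  | last => rw [copiesAndOne_last]; norm_num [SporadicTask.IsConstrained]
  | cast i =>
    rw [copiesAndOne_castSucc]
    obtain ⟨h1, h2, h3⟩ := hσ ((copyEquiv n M K).symm i).1
    exact ⟨mul_pos hc h1, h2, h3⟩

theorem copiesAndOne_monotone (hσ : Monotone fun t => (σ t).D) (h1 : ∀ t, (σ t).D ≤ 1) :
    Monotone fun i => (copiesAndOne M K c σ i).D := by
  intro i j hij
  induction j using Fin.lastCases with
  | last =>
    simp only [copiesAndOne_last]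
    induction i using Fin.lastCases with
    | last => rw [copiesAndOne_last]
    | cast i => rw [copiesAndOne_castSucc]; exact h1 _
  | cast j =>
    induction i using Fin.lastCases with
    | last => exact absurd hij (not_le.2 (Fin.castSucc_lt_last j))
    | cast i =>
      simp only [copiesAndOne_castSucc]
      exact hσ (copyEquiv_symm_fst_monotone n M K (Fin.castSucc_le_castSucc_iff.1 hij))

theorem copiesAndOne_partitionedFeasible (hc : 0 < c) (hσ : ∀ t, (σ t).IsConstrained)
    (hdem : ∀ L, 0 ≤ L → M * c * ∑ t, (σ t).demand L ≤ L) :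
    PartitionedFeasible (K + 1) (copiesAndOne M K c σ) := by
  classical
  set ref : Fin (n * (M * K) + 1) → Fin (K + 1) := Fin.snoc (α := fun _ => Fin (K + 1))
    (fun i => ((copyEquiv n M K).symm i).2.2.castSucc) (Fin.last K) with href
  have href1 : ∀ i : Fin (n * (M * K)),
      ref i.castSucc = ((copyEquiv n M K).symm i).2.2.castSucc := by
    intro i; simp [href]
  have href2 : ref (Fin.last _) = Fin.last K := by simp [href]
  refine ⟨ref, fun m => feasible_one_of_demand
    (fun i => copiesAndOne_isConstrained hc hσ _) fun L hL => ?_⟩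
  have hsum : ∑ i : {i // ref i = m}, (copiesAndOne M K c σ i).demand L =
      ∑ i, if ref i = m then (copiesAndOne M K c σ i).demand L else 0 := by
    rw [← Finset.sum_filter]
    exact (Finset.sum_subtype (p := fun i => ref i = m) (Finset.univ.filter fun i => ref i = m)
      (fun i => by simp) fun i => (copiesAndOne M K c σ i).demand L).symm
  rw [hsum, Fin.sum_univ_castSucc]
  simp only [href1, href2, copiesAndOne_castSucc, copiesAndOne_last]
  induction m using Fin.lastCases with
  | last =>
    have : ∀ j : Fin K, j.castSucc ≠ Fin.last K := fun j => (Fin.castSucc_lt_last j).ne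
    simp only [this, if_false, Finset.sum_const_zero, if_true, zero_add]
    rw [demand_of_implicit one_pos, mul_one, div_one]
    exact Nat.floor_le hL
  | cast j =>
    have : Fin.last K ≠ j.castSucc := (Fin.castSucc_lt_last j).ne'
    simp only [this, if_false, add_zero, Fin.castSucc_inj]
    rw [← Finset.sum_filter]
    rw [sum_copyEquiv (fun t => ((σ t).scale c).demand L) (fun x => x.2 = j)]
    simp only [card_filter_snd_eq, SporadicTask.demand_scale, nsmul_eq_mul]
    refine le_trans (le_of_eq ?_) (hdem L hL)
    rw [Finset.mul_sum]
    exact Finset.sum_congr rfl fun t _ => by ring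

theorem copiesAndOne_dmCanFail {a ρ : ℝ} (hρ : 0 < ρ) (hn : 0 < n) (hM : 0 < M) (hK : 0 < K)
    (ha : 0 < a)
    (hC : ∀ t, 0 ≤ (σ t).C) (hT : ∀ t, a ≤ (σ t).T) (hD : ∀ t, a ≤ (σ t).D)
    (hsum : ∑ t, (σ t).C ≤ a / 2)
    (htda : ∀ t, 0 < t → t ≤ 1 → t < 1 / ρ + ∑ i, (⌈t / (σ i).T⌉ : ℝ) * (σ i).C)
    (hhyp : 2 < (1 / ρ + ∑ i, (if 1 ≤ (σ i).T then (σ i).C else 0) + 1) *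
      ∏ i, (if (σ i).T < 1 then (σ i).U + 1 else 1)) :
    DMCanFail (tdaTest fun i => (copiesAndOne M K (ρ / K) σ i).atSpeed ρ) M ∧
    DMCanFail (hyperbolicTest fun i => (copiesAndOne M K (ρ / K) σ i).atSpeed ρ) M := by
  classical
  have hK' : (0 : ℝ) < K := by exact_mod_cast hK
  have hN : 0 < n * (M * K) := by positivity
  set e := copyEquiv n M K with he
  set τ := fun i => (copiesAndOne M K (ρ / K) σ i).atSpeed ρ with hτ
  have hτ1 : ∀ i, τ (Fin.castSuccEmb i) = (σ (e.symm i).1).scale (1 / K) := by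
    intro i
    simp only [hτ, Fin.coe_castSuccEmb, copiesAndOne_castSucc, SporadicTask.atSpeed,
      SporadicTask.scale, ← he]
    congr 1
    field_simp
  have hτ2 : τ (Fin.last _) = ⟨1 / ρ, 1, 1⟩ := by
    simp only [hτ, copiesAndOne_last, SporadicTask.atSpeed]
  set asg : Fin (n * (M * K)) → Fin M := fun i => (e.symm i).2.1 with hasg
  have hasg0 : (asg ⟨0, hN⟩).val = 0 := copyEquiv_symm_zero hN
  have hCK : ∀ t, 0 ≤ ((σ t).scale (1 / K)).C := fun t => by
    have := hC t
    simp only [SporadicTask.scale]; positivity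
  have hgroup : ∀ k : Fin (n * (M * K)), ∀ P : Finset (Fin (n * (M * K))),
      (∀ i ∈ P, i < k ∧ asg i = asg k) →
      (τ k.castSucc).C + ∑ i ∈ P.map Fin.castSuccEmb, (τ i).C ≤ a / 2 := by
    intro k P hP
    refine le_trans ?_ hsum
    have hk : k ∉ P := fun h => lt_irrefl _ (hP k h).1
    have h1 := hτ1 k
    rw [Fin.coe_castSuccEmb] at h1
    simp only [Finset.sum_map, hτ1, h1]
    rw [← Finset.sum_insert (f := fun i => ((σ (e.symm i).1).scale (1 / K)).C) hk]
    refine (Finset.sum_le_sum_of_subset_of_nonneg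
      (t := Finset.univ.filter (fun i => asg i = asg k)) ?_ fun i _ _ => hCK _).trans ?_
    · intro i hi
      rcases Finset.mem_insert.1 hi with rfl | hi
      · simp
      · simp [(hP i hi).2]
    · rw [hasg, sum_copyEquiv (fun t => ((σ t).scale (1 / K)).C) (fun x => x.1 = _)]
      refine Finset.sum_le_sum fun t _ => le_of_eq ?_
      rw [card_filter_fst_eq, nsmul_eq_mul]
      simp only [SporadicTask.scale]
      field_simp
  have hTP : ∀ P : Finset (Fin (n * (M * K))), ∀ i ∈ P.map Fin.castSuccEmb, a ≤ (τ i).T := by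
    intro P i hi
    obtain ⟨i, -, rfl⟩ := Finset.mem_map.1 hi
    rw [hτ1]; exact hT _
  have hCP : ∀ P : Finset (Fin (n * (M * K))), ∀ i ∈ P.map Fin.castSuccEmb, 0 ≤ (τ i).C := by
    intro P i hi
    obtain ⟨i, -, rfl⟩ := Finset.mem_map.1 hi
    rw [hτ1]; exact hCK _
  have hDk : ∀ k : Fin (n * (M * K)), a ≤ (τ k.castSucc).D := fun k => by
    rw [← Fin.coe_castSuccEmb, hτ1]; exact hD _
  have hCk : ∀ k : Fin (n * (M * K)), 0 ≤ (τ k.castSucc).C := fun k => by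
    rw [← Fin.coe_castSuccEmb, hτ1]; exact hCK _
  constructor
  · refine DMCanFail.of_assignment asg hN hasg0 (fun k P hP => tdaTest_of_sum_le ha (hTP P) (hCP P)
      (hDk k) ((hgroup k P hP).trans (by linarith))) fun m => ?_
    rintro ⟨t, ht0, ht1, ht⟩
    simp only [hτ2, Finset.sum_map, hτ1] at ht ht1
    rw [hasg, sum_copyEquiv (fun i => (⌈t / ((σ i).scale (1 / K)).T⌉ : ℝ) *
      ((σ i).scale (1 / K)).C) (fun x => x.1 = m)] at ht
    refine absurd (htda t ht0 ht1) (not_lt.2 (le_trans (le_of_eq ?_) ht))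
    congr 1
    refine Finset.sum_congr rfl fun i _ => ?_
    rw [card_filter_fst_eq, nsmul_eq_mul]
    simp only [SporadicTask.scale]
    field_simp
  · refine DMCanFail.of_assignment asg hN hasg0 (fun k P hP => hyperbolicTest_of_sum_le ha (hTP P)
      (hCP P) (hCk k) (hDk k) (hgroup k P hP)) fun m => ?_
    intro h
    simp only [hyperbolicTest, hτ2, Finset.sum_filter, Finset.prod_filter, Finset.sum_map,
      Finset.prod_map, hτ1] at h
    rw [← Finset.sum_filter, ← Finset.prod_filter] at h
    rw [hasg, sum_copyEquiv (fun i => if 1 ≤ ((σ i).scale (1 / K)).T then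
      ((σ i).scale (1 / K)).C else 0) (fun x => x.1 = m),
      prod_copyEquiv (fun i => if ((σ i).scale (1 / K)).T < 1 then
      ((σ i).scale (1 / K)).U + 1 else 1) (fun x => x.1 = m), card_filter_fst_eq, div_one] at h
    refine absurd hhyp (not_lt.2 (le_trans ?_ h))
    have hρ' : 0 < 1 / ρ := by positivity
    have hs : ∑ i, K • (if 1 ≤ ((σ i).scale (1 / K)).T then ((σ i).scale (1 / K)).C else 0) =
        ∑ i, (if 1 ≤ (σ i).T then (σ i).C else 0) := by
      refine Finset.sum_congr rfl fun i _ => ?_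
      rw [nsmul_eq_mul]
      by_cases hi : 1 ≤ (σ i).T
      · rw [if_pos (show 1 ≤ ((σ i).scale (1 / K)).T from hi), if_pos hi]
        simp only [SporadicTask.scale]
        field_simp
      · rw [if_neg (show ¬ 1 ≤ ((σ i).scale (1 / K)).T from hi), if_neg hi, mul_zero]
    rw [hs]
    have hs0 : 0 ≤ ∑ i, (if 1 ≤ (σ i).T then (σ i).C else 0) :=
      Finset.sum_nonneg fun i _ => by split_ifs; exacts [hC i, le_rfl]
    have hU : ∀ i, 0 ≤ (σ i).U := fun i => div_nonneg (hC i) (ha.le.trans (hT i))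
    refine mul_le_mul_of_nonneg_left (Finset.prod_le_prod (fun i _ => ?_) fun i _ => ?_)
      (by positivity)
    · split_ifs
      · linarith [hU i]
      · norm_num
    · have e1 : ((σ i).scale (1 / K)).U = (σ i).U / K := by
        simp only [SporadicTask.scale, SporadicTask.U]; ring
      have e2 : ((σ i).scale (1 / K)).T = (σ i).T := rfl
      rw [e1, e2]
      split_ifs
      · have h0 : 0 ≤ (σ i).U / K := div_nonneg (hU i) hK'.le
        have := one_add_mul_le_pow (a := (σ i).U / K) (by linarith) K
        rw [mul_div_cancel₀ _ hK'.ne'] at this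
        rw [add_comm, add_comm ((σ i).U / K)]
        exact this
      · simp

end Copies

/-- `n` implicit-deadline tasks with equidistant periods in `[2w, 1)`, and one task with relative
deadline `1` and a long period. -/
noncomputable def equidistantTypes (w : ℝ) (n : ℕ) : Fin (n + 1) → SporadicTask :=
  Fin.snoc (α := fun _ => SporadicTask)
    (fun i : Fin n => ⟨(1 - 2 * w) / n, 2 * w + i.val * ((1 - 2 * w) / n),
      2 * w + i.val * ((1 - 2 * w) / n)⟩) ⟨3 * w - 1, n, 1⟩

theorem equidistantTypes_castSucc (w : ℝ) {n : ℕ} (i : Fin n) :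
    equidistantTypes w n i.castSucc = ⟨(1 - 2 * w) / n, 2 * w + i.val * ((1 - 2 * w) / n),
      2 * w + i.val * ((1 - 2 * w) / n)⟩ := by
  simp [equidistantTypes]

theorem equidistantTypes_last (w : ℝ) (n : ℕ) :
    equidistantTypes w n (Fin.last n) = ⟨3 * w - 1, n, 1⟩ := by
  simp [equidistantTypes]

theorem le_sum_ceil_mul {a h t : ℝ} (ha : 0 < a) (hh : 0 < h) (ht : 0 < t) (n : ℕ) :
    n * h + min (t - a) (n * h) ≤ ∑ i ∈ Finset.range n, (⌈t / (a + i * h)⌉ : ℝ) * h := by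
  induction n with
  | zero => simp
  | succ n ih =>
    rw [Finset.sum_range_succ]
    have hT : 0 < a + n * h := by positivity
    push_cast
    rcases le_or_gt (t - a) (n * h) with hle | hlt
    · rw [min_eq_left hle] at ih
      rw [min_eq_left (by linarith)]
      have : (1 : ℝ) ≤ ⌈t / (a + n * h)⌉ := by
        exact_mod_cast Int.one_le_ceil_iff.2 (div_pos ht hT)
      nlinarith
    · rw [min_eq_right hlt.le] at ih
      have h2 := min_le_right (t - a) ((n + 1) * h)
      have : (2 : ℝ) ≤ ⌈t / (a + n * h)⌉ := by
        have : (1 : ℤ) < ⌈t / (a + n * h)⌉ := Int.lt_ceil.2 (by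
          rw [Int.cast_one, one_lt_div hT]; linarith)
        exact_mod_cast this
      nlinarith

theorem prod_equidistant {a h : ℝ} (ha : 0 < a) (hh : 0 < h) (n : ℕ) :
    ∏ i ∈ Finset.range n, (h / (a + i * h) + 1) = (a + n * h) / a := by
  induction n with
  | zero => simp [ha.ne']
  | succ n ih =>
    rw [Finset.prod_range_succ, ih]
    have hT : 0 < a + n * h := by positivity
    push_cast
    field_simp
    ring

section Equidistant

variable {w : ℝ} {n : ℕ}

theorem equidistantTypes_isConstrained (hw1 : 1 / 3 < w) (hw2 : w < 1 / 2) (hn : 0 < n) (t) :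
    (equidistantTypes w n t).IsConstrained := by
  have hn' : (1 : ℝ) ≤ n := by exact_mod_cast hn
  have hh : 0 < (1 - 2 * w) / n := div_pos (by linarith) (by linarith)
  induction t using Fin.lastCases with
  | last =>
    rw [equidistantTypes_last]
    exact ⟨by simp only; linarith, one_pos, hn'⟩
  | cast i =>
    rw [equidistantTypes_castSucc]
    exact ⟨hh, by positivity, le_rfl⟩

theorem equidistant_lt_one (hw2 : w < 1 / 2) (i : Fin n) :
    2 * w + i.val * ((1 - 2 * w) / n) < 1 := by
  have hi : (i.val : ℝ) < n := by exact_mod_cast i.isLt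
  have hn : (0 : ℝ) < n := lt_of_le_of_lt (Nat.cast_nonneg _) hi
  have : i.val * ((1 - 2 * w) / n) < n * ((1 - 2 * w) / n) :=
    mul_lt_mul_of_pos_right hi (div_pos (by linarith) hn)
  rw [mul_div_cancel₀ _ hn.ne'] at this
  linarith

theorem equidistantTypes_D_le (hw2 : w < 1 / 2) (t) : (equidistantTypes w n t).D ≤ 1 := by
  induction t using Fin.lastCases with
  | last => rw [equidistantTypes_last]
  | cast i =>
    rw [equidistantTypes_castSucc]
    exact (equidistant_lt_one hw2 i).le

theorem equidistantTypes_monotone (hw2 : w < 1 / 2) :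
    Monotone fun t => (equidistantTypes w n t).D := by
  intro i j hij
  induction j using Fin.lastCases with
  | last =>
    simp only [equidistantTypes_last]
    exact equidistantTypes_D_le hw2 i
  | cast j =>
    induction i using Fin.lastCases with
    | last => exact absurd hij (not_le.2 (Fin.castSucc_lt_last j))
    | cast i =>
      simp only [equidistantTypes_castSucc]
      have : (i.val : ℝ) ≤ j.val := by exact_mod_cast Fin.castSucc_le_castSucc_iff.1 hij
      have : 0 ≤ (1 - 2 * w) / n := div_nonneg (by linarith) (Nat.cast_nonneg _)
      gcongr

theorem le_equidistantTypes_T_D (hw2 : w < 1 / 2) (hn : 0 < n) (t) :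
    2 * w ≤ (equidistantTypes w n t).T ∧ 2 * w ≤ (equidistantTypes w n t).D := by
  have hn' : (1 : ℝ) ≤ n := by exact_mod_cast hn
  induction t using Fin.lastCases with
  | last =>
    rw [equidistantTypes_last]
    constructor <;> simp only <;> linarith
  | cast i =>
    rw [equidistantTypes_castSucc]
    have : 0 ≤ i.val * ((1 - 2 * w) / n) :=
      mul_nonneg (Nat.cast_nonneg _) (div_nonneg (by linarith) (Nat.cast_nonneg _))
    constructor <;> simp only <;> linarith

theorem equidistantTypes_demand (hw1 : 1 / 2.843065 < w) (hw2 : w < 1 / 2.843055)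
    (hlog : Real.log (2 * w) = -w) (hn : 0 < n) {L : ℝ} (hL : 0 ≤ L) :
    ∑ t, (equidistantTypes w n t).demand L ≤ (w + 1 / n) * L := by
  have hn' : (0 : ℝ) < n := by exact_mod_cast hn
  have hmain := sum_min_le_lambertW hw1 hw2 hlog hL
  norm_num at hw1 hw2
  have hh : 0 < (1 - 2 * w) / n := div_pos (by linarith) hn'
  have hfl := sum_floor_mul_le (a := 2 * w) (n := n) (L := L) (by linarith) hh
    (mul_div_cancel₀ _ hn'.ne') hL
  rw [Fin.sum_univ_castSucc]
  simp only [equidistantTypes_castSucc, equidistantTypes_last]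
  have hlong := demand_le_of_nonneg (a := ⟨3 * w - 1, n, 1⟩) (L := L)
    (by simp only; linarith) hn' zero_le_one
  have hlong' : SporadicTask.demand ⟨3 * w - 1, n, 1⟩ L ≤
      (if 1 ≤ L then 3 * w - 1 else 0) + L / n * (3 * w - 1) := by
    refine hlong.trans ?_
    simp only
    have : 0 ≤ L / n * (3 * w - 1) := mul_nonneg (by positivity) (by linarith)
    split_ifs <;> linarith
  have hshort : ∑ i : Fin n, SporadicTask.demand ⟨(1 - 2 * w) / n,
      2 * w + i.val * ((1 - 2 * w) / n), 2 * w + i.val * ((1 - 2 * w) / n)⟩ L =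
      ∑ i ∈ Finset.range n, (⌊L / (2 * w + i * ((1 - 2 * w) / n))⌋₊ : ℝ) * ((1 - 2 * w) / n) := by
    rw [← Fin.sum_univ_eq_sum_range
      (fun i : ℕ => (⌊L / (2 * w + i * ((1 - 2 * w) / n))⌋₊ : ℝ) * ((1 - 2 * w) / n))]
    refine Finset.sum_congr rfl fun i _ => demand_of_implicit ?_
    have : 0 ≤ i.val * ((1 - 2 * w) / n) := by positivity
    linarith
  rw [hshort]
  have herr : L / (2 * w) * ((1 - 2 * w) / n) + L / n * (3 * w - 1) ≤ L / n := by
    have e : L / (2 * w) * ((1 - 2 * w) / n) = L / n * ((1 - 2 * w) / (2 * w)) := by ring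
    rw [e, ← mul_add]
    apply mul_le_of_le_one_right (by positivity)
    have : (1 - 2 * w) / (2 * w) ≤ 1 / 2 := by
      rw [div_le_iff₀ (by linarith)]; linarith
    linarith
  have e : (w + 1 / n) * L = w * L + L / n := by ring
  rw [e]
  linarith

theorem sum_equidistantTypes_C (hn : 0 < n) : ∑ t, (equidistantTypes w n t).C = 2 * w / 2 := by
  have hn' : (n : ℝ) ≠ 0 := by exact_mod_cast hn.ne'
  rw [Fin.sum_univ_castSucc]
  simp only [equidistantTypes_castSucc, equidistantTypes_last, Finset.sum_const, Finset.card_univ,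
    Fintype.card_fin, nsmul_eq_mul]
  field_simp
  ring

theorem equidistantTypes_ceil (hw1 : 1 / 3 < w) (hw2 : w < 1 / 2) (hn : 0 < n) {c t : ℝ}
    (hc : w < c) (ht : 0 < t) (ht1 : t ≤ 1) :
    t < c + ∑ i, (⌈t / (equidistantTypes w n i).T⌉ : ℝ) * (equidistantTypes w n i).C := by
  have hn' : (0 : ℝ) < n := by exact_mod_cast hn
  have hh : 0 < (1 - 2 * w) / n := div_pos (by linarith) hn'
  have h1 := le_sum_ceil_mul (a := 2 * w) (by linarith) hh ht n
  rw [mul_div_cancel₀ _ hn'.ne', min_eq_left (by linarith)] at h1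
  rw [Fin.sum_univ_castSucc]
  simp only [equidistantTypes_castSucc, equidistantTypes_last]
  rw [Fin.sum_univ_eq_sum_range
    (fun i : ℕ => (⌈t / (2 * w + i * ((1 - 2 * w) / n))⌉ : ℝ) * ((1 - 2 * w) / n))]
  have h2 : (1 : ℝ) ≤ ⌈t / (n : ℝ)⌉ := by
    exact_mod_cast Int.one_le_ceil_iff.2 (div_pos ht hn')
  nlinarith

theorem equidistantTypes_hyperbolic (hw1 : 1 / 3 < w) (hw2 : w < 1 / 2) (hn : 0 < n) {c : ℝ}
    (hc : w < c) :
    2 < (c + ∑ i, (if 1 ≤ (equidistantTypes w n i).T then (equidistantTypes w n i).C else 0) + 1) *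
      ∏ i, (if (equidistantTypes w n i).T < 1 then (equidistantTypes w n i).U + 1 else 1) := by
  have hn1 : (1 : ℝ) ≤ n := by exact_mod_cast hn
  have hn' : (0 : ℝ) < n := by linarith
  have hh : 0 < (1 - 2 * w) / n := div_pos (by linarith) hn'
  rw [Fin.sum_univ_castSucc, Fin.prod_univ_castSucc]
  simp only [equidistantTypes_castSucc, equidistantTypes_last, SporadicTask.U, hn1,
    equidistant_lt_one hw2, not_le.2 (equidistant_lt_one hw2 _), not_lt.2 hn1, if_true, if_false,
    Finset.sum_const_zero]
  rw [Fin.prod_univ_eq_prod_range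
    (fun i : ℕ => (1 - 2 * w) / n / (2 * w + i * ((1 - 2 * w) / n)) + 1),
    prod_equidistant (by linarith) hh, mul_div_cancel₀ _ hn'.ne', mul_one, add_sub_cancel,
    mul_one_div, lt_div_iff₀ (by linarith)]
  linarith

end Equidistant

/-- A task set on which deadline-monotonic partitioning fails at speed `ρ`. -/
theorem exists_feasible_dmCanFail {K : ℕ} (hK : 0 < K) {ρ : ℝ} (hρ : 0 < ρ)
    (hρw : ρ * lambertW (1 / 2) < 1)
    (hρK : (K + 1) * (ρ / K) * (lambertW (1 / 2) + 1 / K) ≤ 1) :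
    ∃ (N : ℕ) (τ : Fin N → SporadicTask), (∀ i, (τ i).IsConstrained) ∧
      (Monotone fun i => (τ i).D) ∧ PartitionedFeasible (K + 1) τ ∧
      DMCanFail (tdaTest fun i => (τ i).atSpeed ρ) (K + 1) ∧
      DMCanFail (hyperbolicTest fun i => (τ i).atSpeed ρ) (K + 1) := by
  have hw1 := lambertW_half_gt
  have hw2 := lambertW_half_lt
  have hlog := log_two_mul_lambertW_half
  set w := lambertW (1 / 2) with hw
  have hw1' : 1 / 3 < w := lt_trans (by norm_num) hw1
  have hw2' : w < 1 / 2 := lt_trans hw2 (by norm_num)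
  have hK' : (0 : ℝ) < K := by exact_mod_cast hK
  have hc : 0 < ρ / K := by positivity
  have hcon := equidistantTypes_isConstrained hw1' hw2' hK
  have hwρ : w < 1 / ρ := by rw [lt_div_iff₀ hρ]; linarith
  refine ⟨_, copiesAndOne (K + 1) K (ρ / K) (equidistantTypes w K),
    copiesAndOne_isConstrained hc hcon,
    copiesAndOne_monotone (equidistantTypes_monotone hw2') (equidistantTypes_D_le hw2'),
    copiesAndOne_partitionedFeasible hc hcon fun L hL => ?_,
    copiesAndOne_dmCanFail hρ (Nat.succ_pos K) (Nat.succ_pos K) hK (a := 2 * w) (by linarith)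
      (fun t => (hcon t).1.le) (fun t => (le_equidistantTypes_T_D hw2' hK t).1)
      (fun t => (le_equidistantTypes_T_D hw2' hK t).2) (sum_equidistantTypes_C hK).le
      (fun t ht ht1 => equidistantTypes_ceil hw1' hw2' hK hwρ ht ht1)
      (equidistantTypes_hyperbolic hw1' hw2' hK hwρ)⟩
  have hdem := equidistantTypes_demand hw1 hw2 hlog hK hL
  push_cast
  calc _ ≤ (K + 1) * (ρ / K) * ((w + 1 / K) * L) := by gcongr
    _ = (K + 1) * (ρ / K) * (w + 1 / K) * L := by ring
    _ ≤ 1 * L := by gcongr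
    _ = L := one_mul L

theorem exists_threshold {ε : ℝ} (hε : 0 < ε) : ∃ M₀ : ℕ, ∀ M : ℕ, M₀ ≤ M → ∀ ρ : ℝ, 0 < ρ →
    ρ < 1 / lambertW (1 / 2) - ε → ∃ K : ℕ, M = K + 1 ∧ 0 < K ∧ ρ * lambertW (1 / 2) < 1 ∧
      (K + 1) * (ρ / K) * (lambertW (1 / 2) + 1 / K) ≤ 1 := by
  have hw1 := lambertW_half_gt
  have hw2 := lambertW_half_lt
  set w := lambertW (1 / 2) with hw
  norm_num at hw1 hw2
  have hw0 : 0 < w := by linarith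
  obtain ⟨K₀, hK₀⟩ := exists_nat_gt (7 / (ε * w))
  have hεw : 0 < ε * w := by positivity
  refine ⟨K₀ + 2, fun M hM ρ hρ hρε => ⟨M - 1, by omega, by omega, ?_, ?_⟩⟩
  all_goals
    have h1 : ρ * w < 1 - ε * w := by
      have := mul_lt_mul_of_pos_right hρε hw0
      rwa [sub_mul, one_div, inv_mul_cancel₀ hw0.ne'] at this
  · linarith
  · obtain ⟨K, rfl⟩ : ∃ K, M = K + 1 := ⟨M - 1, by omega⟩
    rw [Nat.add_sub_cancel]
    have hK1 : (1 : ℝ) ≤ K := by exact_mod_cast (show 1 ≤ K by omega)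
    have hKK : (K₀ : ℝ) ≤ K := by exact_mod_cast (show K₀ ≤ K by omega)
    have h7 : 7 < K * (ε * w) := by
      rw [div_lt_iff₀ hεw] at hK₀
      nlinarith
    have hρ3 : ρ ≤ 3 := by nlinarith
    have e : (K + 1) * (ρ / K) * (w + 1 / K) = (K + 1) * ρ * (K * w + 1) / (K * K : ℝ) := by
      field_simp
    rw [e, div_le_one (by positivity)]
    have h2 : K * (K * (ρ * w)) ≤ K * (K * (1 - ε * w)) := by gcongr
    have h3 : K * 7 ≤ K * (K * (ε * w)) := by gcongr
    nlinarith

theorem mainTheorem8 :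
    |1 / lambertW (1 / 2) - 2.84306| < 0.000005 ∧
    ∀ ε : ℝ, 0 < ε → ∃ M₀ : ℕ, ∀ M : ℕ, M₀ ≤ M → ∀ ρ : ℝ, 0 < ρ →
      (HasSpeedupFactor Feasible tdaTest M ρ → 1 / lambertW (1 / 2) - ε ≤ ρ) ∧
      (HasSpeedupFactor Feasible hyperbolicTest M ρ → 1 / lambertW (1 / 2) - ε ≤ ρ) ∧
      (HasSpeedupFactor PartitionedFeasible tdaTest M ρ → 1 / lambertW (1 / 2) - ε ≤ ρ) ∧
      (HasSpeedupFactor PartitionedFeasible hyperbolicTest M ρ →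
        1 / lambertW (1 / 2) - ε ≤ ρ) := by
  refine ⟨abs_inv_lambertW_half_sub_lt, fun ε hε => ?_⟩
  obtain ⟨M₀, hM₀⟩ := exists_threshold hε
  refine ⟨M₀, fun M hM ρ hρ => ?_⟩
  by_cases hlt : ρ < 1 / lambertW (1 / 2) - ε
  · obtain ⟨K, rfl, hK, h1, h2⟩ := hM₀ M hM ρ hρ hlt
    obtain ⟨N, τ, hcon, hmono, hpart, htda, hhyp⟩ := exists_feasible_dmCanFail hK hρ h1 h2
    exact ⟨fun h => absurd htda (h N τ hcon hmono hpart.feasible),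
      fun h => absurd hhyp (h N τ hcon hmono hpart.feasible),
      fun h => absurd htda (h N τ hcon hmono hpart),
      fun h => absurd hhyp (h N τ hcon hmono hpart)⟩
  · have hle := not_lt.1 hlt
    exact ⟨fun _ => hle, fun _ => hle, fun _ => hle, fun _ => hle⟩
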